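/- Let $R$ be a euclidean ring (that is, a Euclidean domain), let $n\ge 6$ be an integer, and let $\Gamma=SL_n(R)$ be the group of $n\times n$ matrices over $R$ of determinant $1$. Then: (1) Every quasi-homomorphism on $\Gamma$ is bounded: if $\psi\colon\Gamma\to\mathbb{R}$ satisfies $\sup_{g,h\in\Gamma}|\psi(gh)-\psi(g)-\psi(h)|<\infty$, then $\sup_{g\in\Gamma}|\psi(g)|<\infty$. (2) The stable commutator length vanishes on $\Gamma$: every $g\in\Gamma$ lies in the commutator subgroup $[\Gamma,\Gamma]$, and $$\mathrm{scl}(g)=\lim_{k\to\infty}\frac{\mathrm{cl}(g^k)}{k}=0,$$ where $\mathrm{cl}(h)$ is the least number of commutators in $\Gamma$ whose product is $h$ (with $\mathrm{cl}(1)=0$). In particular, both conclusions hold for $\Gamma=SL_n(F[x])$ for every field $F$. -/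

import Mathlib

/-- A quasi-homomorphism on a group `G`: a real function with finite defect
`sup |ψ (g * h) - ψ g - ψ h|`. -/
def IsQuasiHomomorphism {G : Type*} [Group G] (ψ : G → ℝ) : Prop :=
  ∃ D : ℝ, ∀ g h : G, |ψ (g * h) - ψ g - ψ h| ≤ D

/-- The commutator length of `g`: the least number of commutators whose product is `g`.
It is meaningful for `g` in the commutator subgroup (and is `0` by convention elsewhere). The
identity is the empty product, so it has length `0`. -/
noncomputable def commutatorLength {G : Type*} [Group G] (g : G) : ℕ :=
  sInf {k : ℕ | ∃ l : List G, l.length = k ∧ (∀ c ∈ l, c ∈ commutatorSet G) ∧ l.prod = g}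

/-- `HasStableCommutatorLength g s` says that `g` lies in the commutator subgroup, that the limit of
`cl (g ^ k) / k` as `k → ∞` exists, and that this limit, the stable commutator length of `g`,
equals `s`. -/
def HasStableCommutatorLength {G : Type*} [Group G] (g : G) (s : ℝ) : Prop :=
  g ∈ commutator G ∧
    Filter.Tendsto (fun k : ℕ => (commutatorLength (g ^ k) : ℝ) / (k : ℝ)) Filter.atTop (nhds s)

/-!
The theorem holds because the stable commutator length is bounded on `SLₙ(R)`: it is homogeneous,
`scl (g ^ N) = N * scl g`, so a uniform bound forces it to vanish, and a uniform bound on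
commutator lengths of powers also bounds every quasi-homomorphism, since the latter grows at most
linearly in the number of commutators. Accordingly everything is measured by `Near c x y`, which
says that `x` and `y` differ by at most `c` commutators; this relation is compatible with products
and homomorphisms, conjugate elements differ by one commutator, and for matrices of size at least
three an elementary operation costs one commutator.

A Euclidean domain has stable range two, so a number of elementary operations depending only on `n`
reduces a matrix to the image of `SL₂(R)` (`exists_near_stabilize`). A matrix of `SL₂(R)` in the
corner of `SL₃(R)` is determined up to one commutator by its first row `(a, b)`. The class of this
matrix behaves like a Mennicke symbol with bounded errors: it is invariant under elementary
operations on `(a, b)`, and multiplicative in each entry (`near_mennicke_mul`).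

A Mennicke symbol over a Euclidean domain is trivial by the Euclidean algorithm, but the number of
steps is unbounded, so the errors would add up. They are beaten by passing to powers.
On the one hand `(a ^ l, b ^ l)` represents the `l ^ 2`-th power of `(a, b)` up to `65 l ^ 2 + O(l)`
commutators (`near_mennicke_pow_pow`). On the other hand, a step of the Euclidean algorithm on
`(a, b)` changes the symbol of `(a ^ l, b ^ l)` by only `O(l)` commutators: that symbol is, up to
`O(l)`, the `l`-th power of the symbol of `(a, b ^ l)`, whose second entry may be reduced modulo `a`
(`near_mennicke_pow_add_mul`). Hence the symbol of `(a ^ l, b ^ l)` has length `O(l)`, with a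
constant depending on `a` and `b`, and the `l ^ 2`-th power of the symbol of `(a, b)` has length at
most `65 l ^ 2 + O(l)`. The leading constant is uniform, which is what is needed.
-/

open Matrix Filter

open scoped Pointwise commutatorElement

/-! ### Elements at bounded commutator distance -/

section Group

variable {G H : Type*} [Group G] [Group H]

/-- `Near c x y` says that `x` and `y` differ by a product of at most `c` commutators. As the
identity is a commutator, it is enough to speak of exactly `c` factors. -/
def Near (c : ℕ) (x y : G) : Prop := x * y⁻¹ ∈ commutatorSet G ^ c

theorem mem_commutatorSet_pow_iff {c : ℕ} {x : G} :
    x ∈ commutatorSet G ^ c ↔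
      ∃ l : List G, l.length = c ∧ (∀ y ∈ l, y ∈ commutatorSet G) ∧ l.prod = x := by
  rw [Set.mem_pow]
  constructor
  · rintro ⟨f, rfl⟩
    refine ⟨List.ofFn fun i => (f i : G), by simp, ?_, rfl⟩
    intro y hy
    obtain ⟨i, rfl⟩ := List.mem_ofFn.1 hy
    exact (f i).2
  · rintro ⟨l, rfl, hl, rfl⟩
    exact ⟨fun i => ⟨l[i], hl _ (List.getElem_mem _)⟩, by simp⟩

theorem conj_mem_commutatorSet_pow {c : ℕ} {x : G} (hx : x ∈ commutatorSet G ^ c) (g : G) :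
    g * x * g⁻¹ ∈ commutatorSet G ^ c := by
  induction c generalizing x with
  | zero => simp_all
  | succ c ih =>
    rw [pow_succ] at hx ⊢
    obtain ⟨y, hy, z, ⟨p, q, rfl⟩, rfl⟩ := hx
    refine ⟨_, ih hy, _, ⟨g * p * g⁻¹, g * q * g⁻¹, rfl⟩, ?_⟩
    rw [← conjugate_commutatorElement]
    group

theorem inv_mem_commutatorSet_pow {c : ℕ} {x : G} (hx : x ∈ commutatorSet G ^ c) :
    x⁻¹ ∈ commutatorSet G ^ c := by
  induction c generalizing x with
  | zero => simp_all
  | succ c ih =>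
    rw [pow_succ] at hx
    rw [pow_succ']
    obtain ⟨y, hy, z, ⟨p, q, rfl⟩, rfl⟩ := hx
    refine ⟨_, ⟨q, p, rfl⟩, _, ih hy, ?_⟩
    rw [← commutatorElement_inv]
    group

theorem commutatorSet_pow_mono {c d : ℕ} (h : c ≤ d) :
    commutatorSet G ^ c ⊆ commutatorSet G ^ d :=
  Set.pow_subset_pow_right (one_mem_commutatorSet G) h

namespace Near

theorem refl (x : G) : Near 0 x x := by simp [Near]

theorem mono {c d : ℕ} {x y : G} (h : Near c x y) (hcd : c ≤ d) : Near d x y :=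
  commutatorSet_pow_mono hcd h

theorem symm {c : ℕ} {x y : G} (h : Near c x y) : Near c y x := by
  have := inv_mem_commutatorSet_pow h
  rwa [_root_.mul_inv_rev, inv_inv] at this

theorem trans {c d : ℕ} {x y z : G} (h : Near c x y) (h' : Near d y z) : Near (c + d) x z := by
  unfold Near at *
  rw [pow_add]
  exact ⟨_, h, _, h', by group⟩

theorem mul {c d : ℕ} {x y x' y' : G} (h : Near c x y) (h' : Near d x' y') :
    Near (c + d) (x * x') (y * y') := by
  unfold Near at *
  rw [add_comm, pow_add]
  exact ⟨_, conj_mem_commutatorSet_pow h' x, _, h, by group⟩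

theorem pow {c : ℕ} {x y : G} (h : Near c x y) (l : ℕ) : Near (l * c) (x ^ l) (y ^ l) := by
  induction l with
  | zero => simpa using refl (1 : G)
  | succ l ih =>
    rw [pow_succ, pow_succ, Nat.succ_mul]
    exact ih.mul h

theorem conj (g x : G) : Near 1 (g * x * g⁻¹) x := by
  rw [Near, pow_one]
  exact commutator_mem_commutatorSet g x

theorem of_mul {x y : G} (e : G) (he : Near 1 e 1) (h : x = e * y) : Near 1 x y := by
  subst h
  simpa [Near] using he

theorem of_mul_right {x y : G} (e : G) (he : Near 1 e 1) (h : x = y * e) : Near 1 x y := by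
  subst h
  simpa using (refl y).mul he

theorem map {c : ℕ} {x y : G} (f : G →* H) (h : Near c x y) : Near c (f x) (f y) := by
  have key : ∀ (c : ℕ) (z : G), z ∈ commutatorSet G ^ c → f z ∈ commutatorSet H ^ c := by
    intro c
    induction c with
    | zero => intro z; simp +contextual
    | succ c ih =>
      intro z hz
      rw [pow_succ] at hz ⊢
      obtain ⟨y, hy, z, ⟨p, q, rfl⟩, rfl⟩ := hz
      exact ⟨_, ih _ hy, _, ⟨f p, f q, rfl⟩, by simp [map_commutatorElement]⟩
  simpa [Near] using key c _ h

end Near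

/-! ### Stable bounds on commutator length -/

/-- `StablyBounded K g` says that `g ^ l ^ 2` is a product of `K * l ^ 2 + O(l)` commutators; in
particular the stable commutator length of `g` is at most `K`. Only exponents that are squares are
required, since these are what the argument with Mennicke symbols yields. -/
def StablyBounded (K : ℕ) (g : G) : Prop :=
  ∃ E : ℕ, ∀ l : ℕ, 0 < l → Near (K * l ^ 2 + E * l) (g ^ l ^ 2) 1

namespace StablyBounded

theorem of_near {K c : ℕ} {x y : G} (hy : StablyBounded K y) (h : Near c x y) :
    StablyBounded (c + K) x := by
  obtain ⟨E, hE⟩ := hy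
  refine ⟨E, fun l hl => ((h.pow (l ^ 2)).trans (hE l hl)).mono (le_of_eq ?_)⟩
  ring

theorem map {K : ℕ} {x : G} (f : G →* H) (hx : StablyBounded K x) : StablyBounded K (f x) := by
  obtain ⟨E, hE⟩ := hx
  exact ⟨E, fun l hl => by simpa using (hE l hl).map f⟩

theorem mem_commutator {K : ℕ} {x : G} (hx : StablyBounded K x) : x ∈ commutator G := by
  obtain ⟨E, hE⟩ := hx
  have h := hE 1 one_pos
  simp only [Near, one_pow, pow_one, inv_one, mul_one] at h
  obtain ⟨l, -, hl, rfl⟩ := mem_commutatorSet_pow_iff.1 h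
  rw [commutator_eq_closure]
  exact Subgroup.list_prod_mem _ fun y hy => Subgroup.subset_closure (hl y hy)

end StablyBounded

theorem commutatorLength_le {c : ℕ} {g : G} (h : Near c g 1) : commutatorLength g ≤ c := by
  simp only [Near, inv_one, mul_one] at h
  exact Nat.sInf_le (mem_commutatorSet_pow_iff.1 h)

theorem near_commutatorLength {K : ℕ} {g : G} (h : StablyBounded K g) :
    Near (commutatorLength g) g 1 := by
  obtain ⟨E, hE⟩ := h
  have h1 := hE 1 one_pos
  simp only [Near, one_pow, pow_one, inv_one, mul_one] at h1 ⊢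
  rw [mem_commutatorSet_pow_iff] at h1 ⊢
  exact Nat.sInf_mem (s := {k | ∃ l : List G, l.length = k ∧
    (∀ c ∈ l, c ∈ commutatorSet G) ∧ l.prod = g}) ⟨_, h1⟩

/-- A stable bound that is uniform over a group forces stable commutator length zero, because
stable commutator length is homogeneous. -/
theorem hasStableCommutatorLength_zero {K : ℕ} (hK : ∀ g : G, StablyBounded K g) (g : G) :
    HasStableCommutatorLength g 0 := by
  refine ⟨(hK g).mem_commutator, ?_⟩
  set u : ℕ → ℝ := fun k => commutatorLength (g ^ k) with hu
  have hsub : Subadditive u := by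
    intro m n
    simp only [hu]
    rw [pow_add]
    have := (near_commutatorLength (hK (g ^ m))).mul (near_commutatorLength (hK (g ^ n)))
    rw [mul_one] at this
    exact_mod_cast commutatorLength_le this
  have hbdd : BddBelow (Set.range fun n : ℕ => u n / n) :=
    ⟨0, by rintro _ ⟨n, rfl⟩; positivity⟩
  have hlim := hsub.tendsto_lim hbdd
  suffices hsub.lim = 0 by rwa [this] at hlim
  refine le_antisymm ?_ (ge_of_tendsto' hlim fun n => by positivity)
  -- Along the exponents `N * l ^ 2` the quotient is at most `(K + E / l) / N`.
  have hN : ∀ N : ℕ, 0 < N → hsub.lim * N ≤ K := by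
    intro N hN
    obtain ⟨E, hE⟩ := hK (g ^ N)
    have key : ∀ l : ℕ, 0 < l → hsub.lim * N ≤ K + E / l := by
      intro l hl
      have h1 := hsub.lim_le_div hbdd (n := N * l ^ 2) (by positivity)
      have h2 : u (N * l ^ 2) ≤ K * (l : ℝ) ^ 2 + E * l := by
        have h3 := hE l hl
        rw [← pow_mul] at h3
        have h4 := commutatorLength_le h3
        simp only [hu]
        exact_mod_cast h4
      have hl' : (0 : ℝ) < l := by exact_mod_cast hl
      have hN' : (0 : ℝ) < N := by exact_mod_cast hN
      rw [le_div_iff₀ (by positivity)] at h1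
      push_cast at h1
      have h4 : (hsub.lim * N) * (l : ℝ) ^ 2 ≤ (K + E / l) * (l : ℝ) ^ 2 := by
        calc _ = hsub.lim * (N * (l : ℝ) ^ 2) := by ring
          _ ≤ K * (l : ℝ) ^ 2 + E * l := h1.trans h2
          _ = _ := by field_simp
      exact le_of_mul_le_mul_right h4 (by positivity)
    have ht : Tendsto (fun l : ℕ => (K : ℝ) + E / l) atTop (nhds (K + 0)) :=
      tendsto_const_nhds.add (tendsto_const_div_atTop_nhds_zero_nat (E : ℝ))
    rw [add_zero] at ht
    exact ge_of_tendsto ht ((eventually_gt_atTop 0).mono key)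
  by_contra! hpos
  obtain ⟨N, hlt⟩ := exists_nat_gt (K / hsub.lim)
  rw [div_lt_iff₀ hpos] at hlt
  have hN0 : 0 < N := by
    rcases Nat.eq_zero_or_pos N with rfl | h
    · simp only [Nat.cast_zero, zero_mul] at hlt
      exact absurd hlt (not_lt.2 (Nat.cast_nonneg K))
    · exact h
  linarith [hN N hN0, mul_comm hsub.lim (N : ℝ)]

/-- The elementary half of Bavard duality: a quasi-homomorphism grows at most linearly in the
number of commutators. -/
theorem IsQuasiHomomorphism.exists_bound_of_near {ψ : G → ℝ} (hψ : IsQuasiHomomorphism ψ) :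
    ∃ B : ℝ, ∀ (c : ℕ) (g : G), Near c g 1 → |ψ g| ≤ B * (c + 1) := by
  obtain ⟨D, hD⟩ := hψ
  have h1 : |ψ 1| ≤ D := by simpa using hD 1 1
  have hinv : ∀ x, |ψ x + ψ x⁻¹| ≤ 2 * D := by
    intro x
    have := hD x x⁻¹
    rw [mul_inv_cancel] at this
    rw [abs_le] at *
    constructor <;> linarith
  have hcomm : ∀ p q : G, |ψ ⁅p, q⁆| ≤ 7 * D := by
    intro p q
    rw [commutatorElement_def]
    have e1 := hD (p * q * p⁻¹) q⁻¹
    have e2 := hD (p * q) p⁻¹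
    have e3 := hD p q
    have e4 := hinv p
    have e5 := hinv q
    rw [abs_le] at *
    constructor <;> linarith
  refine ⟨8 * D, fun c => ?_⟩
  have hD0 : 0 ≤ D := (abs_nonneg _).trans h1
  induction c with
  | zero =>
    intro g hg
    simp only [Near, inv_one, mul_one, pow_zero, Set.mem_one] at hg
    subst hg
    simp only [Nat.cast_zero]
    linarith
  | succ c ih =>
    intro g hg
    simp only [Near, inv_one, mul_one, pow_succ] at hg ih
    obtain ⟨y, hy, z, ⟨p, q, rfl⟩, rfl⟩ := hg
    have e1 := ih y hy
    have e2 := hcomm p q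
    have e3 := hD y ⁅p, q⁆
    push_cast
    simp only [abs_le] at *
    constructor <;> linarith

theorem IsQuasiHomomorphism.exists_bound_pow {ψ : G → ℝ} (hψ : IsQuasiHomomorphism ψ) :
    ∃ D : ℝ, ∀ (g : G) (k : ℕ), |ψ (g ^ k) - k * ψ g| ≤ (k + 1) * D := by
  obtain ⟨D, hD⟩ := hψ
  refine ⟨D, fun g k => ?_⟩
  induction k with
  | zero => simpa using hD 1 1
  | succ k ih =>
    have := hD (g ^ k) g
    rw [← pow_succ] at this
    push_cast
    rw [abs_le] at *
    constructor <;> linarith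

/-- A stable bound that is uniform over a group bounds every quasi-homomorphism: compare
`ψ (g ^ l ^ 2)` with `l ^ 2 * ψ g` and let `l` tend to infinity. -/
theorem IsQuasiHomomorphism.bounded_of_stablyBounded {K : ℕ} (hK : ∀ g : G, StablyBounded K g)
    {ψ : G → ℝ} (hψ : IsQuasiHomomorphism ψ) : ∃ C : ℝ, ∀ g : G, |ψ g| ≤ C := by
  obtain ⟨B, hB⟩ := hψ.exists_bound_of_near
  obtain ⟨D, hD⟩ := hψ.exists_bound_pow
  refine ⟨B * K + D, fun g => ?_⟩
  obtain ⟨E, hE⟩ := hK g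
  have key : ∀ l : ℕ, 0 < l → |ψ g| ≤ B * K + D + (B * E / l + (B + D) * (1 / l) ^ 2) := by
    intro l hl
    have h1 := hB _ _ (hE l hl)
    have h2 := hD g (l ^ 2)
    have hl' : (0 : ℝ) < l := by exact_mod_cast hl
    push_cast at h1 h2
    have h3 : (l : ℝ) ^ 2 * |ψ g| ≤ B * (K * l ^ 2 + E * l + 1) + (l ^ 2 + 1) * D := by
      have h4 : (l : ℝ) ^ 2 * |ψ g| = |(l : ℝ) ^ 2 * ψ g| := by
        rw [abs_mul, abs_of_pos (by positivity : (0 : ℝ) < (l : ℝ) ^ 2)]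
      have h5 : |(l : ℝ) ^ 2 * ψ g| ≤ |ψ (g ^ l ^ 2)| + |ψ (g ^ l ^ 2) - l ^ 2 * ψ g| := by
        rw [abs_sub_comm (ψ (g ^ l ^ 2))]
        have := abs_add_le (ψ (g ^ l ^ 2)) ((l : ℝ) ^ 2 * ψ g - ψ (g ^ l ^ 2))
        rwa [add_sub_cancel] at this
      linarith
    refine le_of_mul_le_mul_left (h3.trans (le_of_eq ?_)) (by positivity : (0 : ℝ) < (l : ℝ) ^ 2)
    field_simp
    ring
  have ht : Tendsto (fun l : ℕ => B * K + D + (B * E / l + (B + D) * (1 / (l : ℝ)) ^ 2)) atTop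
      (nhds (B * K + D + (0 + (B + D) * 0 ^ 2))) :=
    tendsto_const_nhds.add ((tendsto_const_div_atTop_nhds_zero_nat _).add
      (tendsto_const_nhds.mul (tendsto_one_div_atTop_nhds_zero_nat.pow 2)))
  have h0 : B * K + D + (0 + (B + D) * 0 ^ 2) = B * K + D := by ring
  rw [h0] at ht
  exact ge_of_tendsto ht ((eventually_gt_atTop 0).mono key)

end Group

/-! ### Transvections and Mennicke symbols in degree three -/

section Mennicke

variable {R : Type*} [CommRing R]

theorem sl_ext {ι : Type*} [Fintype ι] [DecidableEq ι] {A B : SpecialLinearGroup ι R}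
    (h : (A : Matrix ι ι R) = B) : A = B :=
  Subtype.ext h

/-- With a third index at hand, a transvection is a single commutator. -/
theorem near_transvection {ι : Type*} [Fintype ι] [DecidableEq ι] {i j : ι} (hij : i ≠ j)
    (k : ι) (hki : k ≠ i) (hkj : k ≠ j) (t : R) :
    Near 1 (SpecialLinearGroup.transvection hij t) 1 := by
  have h : SpecialLinearGroup.transvection hij t =
      ⁅SpecialLinearGroup.transvection hki.symm t, SpecialLinearGroup.transvection hkj 1⁆ := by
    rw [commutatorElement_def, SpecialLinearGroup.transvection_inv,
      SpecialLinearGroup.transvection_inv]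
    refine sl_ext ?_
    simp only [Matrix.SpecialLinearGroup.coe_mul, SpecialLinearGroup.transvection_coe]
    simp [mul_add, add_mul, single_mul_single_of_ne, hij.symm, hki, hkj.symm]
    simp only [← single_neg]
    abel
  rw [Near, pow_one, inv_one, mul_one, h]
  exact commutator_mem_commutatorSet _ _

theorem near_transvection_three {i j : Fin 3} (hij : i ≠ j) (t : R) :
    Near 1 (SpecialLinearGroup.transvection hij t) 1 := by
  obtain ⟨k, hki, hkj⟩ : ∃ k : Fin 3, k ≠ i ∧ k ≠ j := by
    revert i j
    decide
  exact near_transvection hij k hki hkj t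

/-- The matrix with rows `(a, b)` and `(c, d)`, seen in the upper left corner of `SL₃`. -/
def corner (a b c d : R) (h : a * d - b * c = 1) : SpecialLinearGroup (Fin 3) R :=
  ⟨!![a, b, 0; c, d, 0; 0, 0, 1], by rw [det_fin_three]; simpa using h⟩

@[simp]
theorem coe_corner (a b c d : R) (h : a * d - b * c = 1) :
    (corner a b c d h : Matrix (Fin 3) (Fin 3) R) = !![a, b, 0; c, d, 0; 0, 0, 1] :=
  rfl

/-- The Mennicke symbol of a coprime pair `(a, b)`: a matrix in the upper left corner of `SL₃` with
first row `(a, b)`. The second row is chosen arbitrarily, which only matters up to one commutator;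
the value is `1` when `a` and `b` are not coprime. -/
noncomputable def mennicke (a b : R) : SpecialLinearGroup (Fin 3) R :=
  open Classical in
  if h : ∃ c d, a * d - b * c = 1 then
    corner a b h.choose h.choose_spec.choose h.choose_spec.choose_spec
  else 1

theorem near_mennicke {a b c d : R} (h : a * d - b * c = 1) :
    Near 1 (corner a b c d h) (mennicke a b) := by
  have hab : ∃ c d, a * d - b * c = 1 := ⟨c, d, h⟩
  rw [mennicke, dif_pos hab]
  have hvu := hab.choose_spec.choose_spec
  set v := hab.choose
  set u := hab.choose_spec.choose
  refine Near.of_mul _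
    (near_transvection_three (i := 1) (j := 0) (by decide) (c * u - v * d)) (sl_ext ?_)
  ext i j
  fin_cases i <;> fin_cases j <;>
    simp [SpecialLinearGroup.transvection_coe, Matrix.mul_apply, Fin.sum_univ_three,
      Matrix.single, Matrix.one_apply]
  · linear_combination (-c) * hvu + v * h
  · linear_combination (-d) * hvu + u * h

theorem exists_corner {a b : R} (hab : IsCoprime a b) : ∃ c d, a * d - b * c = 1 := by
  obtain ⟨u, v, h⟩ := hab
  exact ⟨-v, u, by linear_combination h⟩

theorem near_mennicke_add_mul_left {a b : R} (hab : IsCoprime a b) (t : R) :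
    Near 3 (mennicke (a + t * b) b) (mennicke a b) := by
  obtain ⟨c, d, h⟩ := exists_corner hab
  have h' : (a + t * b) * d - b * (c + t * d) = 1 := by linear_combination h
  refine ((near_mennicke h').symm.trans
    (Near.of_mul_right _ (near_transvection_three (i := 1) (j := 0) (by decide) t)
      (sl_ext ?_))).trans
    (near_mennicke h)
  ext i j
  fin_cases i <;> fin_cases j <;>
    simp [SpecialLinearGroup.transvection_coe, Matrix.mul_apply, Fin.sum_univ_three,
      Matrix.single, Matrix.one_apply, mul_comm]

theorem near_mennicke_add_mul_right {a b : R} (hab : IsCoprime a b) (t : R) :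
    Near 3 (mennicke a (b + t * a)) (mennicke a b) := by
  obtain ⟨c, d, h⟩ := exists_corner hab
  have h' : a * (d + t * c) - (b + t * a) * c = 1 := by linear_combination h
  refine ((near_mennicke h').symm.trans
    (Near.of_mul_right _ (near_transvection_three (i := 0) (j := 1) (by decide) t)
      (sl_ext ?_))).trans
    (near_mennicke h)
  ext i j
  fin_cases i <;> fin_cases j <;>
    simp [SpecialLinearGroup.transvection_coe, Matrix.mul_apply, Fin.sum_univ_three,
      Matrix.single, Matrix.one_apply, mul_comm, add_comm]

theorem mennicke_one_zero : Near 1 (mennicke (1 : R) 0) 1 := by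
  have h : (1 : R) * 1 - 0 * 0 = 1 := by ring
  have e : corner (1 : R) 0 0 1 h = 1 := by
    ext i j
    fin_cases i <;> fin_cases j <;> simp [corner]
  exact e ▸ (near_mennicke h).symm

theorem near_mennicke_one_left (b : R) : Near 4 (mennicke 1 b) 1 := by
  have := near_mennicke_add_mul_right (isCoprime_one_left (x := (0 : R))) b
  rw [zero_add, mul_one] at this
  exact this.trans mennicke_one_zero

theorem near_mennicke_one_right (a : R) : Near 7 (mennicke a 1) 1 := by
  have := near_mennicke_add_mul_left (isCoprime_one_right (x := (1 : R))) (a - 1)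
  rw [mul_one, add_sub_cancel] at this
  exact this.trans (near_mennicke_one_left 1)

theorem near_mennicke_unit_right (a : R) {b : R} (hb : IsUnit b) : Near 13 (mennicke a b) 1 := by
  obtain ⟨b, rfl⟩ := hb
  have hcop : ∀ x : R, IsCoprime x b := fun x => ⟨0, ↑b⁻¹, by simp⟩
  have h1 := near_mennicke_add_mul_left (hcop a) ((1 - a) * ↑b⁻¹)
  rw [mul_assoc, Units.inv_mul, mul_one, add_sub_cancel] at h1
  exact (h1.symm.trans (near_mennicke_one_left _)).mono (by norm_num)

end Mennicke

/-! ### Multiplicativity of Mennicke symbols -/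

section MennickeMul

variable {R : Type*} [CommRing R]

/-- A corner matrix is conjugate, by the cyclic permutation matrix, to the same block placed in the
lower right corner; hence the two differ by a single commutator. -/
theorem near_lower_corner {a b c d : R} (h : a * d - b * c = 1) {L : SpecialLinearGroup (Fin 3) R}
    (hL : (L : Matrix (Fin 3) (Fin 3) R) = !![1, 0, 0; 0, a, b; 0, c, d]) :
    Near 1 L (corner a b c d h) := by
  let P : SpecialLinearGroup (Fin 3) R :=
    ⟨!![0, 0, 1; 1, 0, 0; 0, 1, 0], by rw [det_fin_three]; simp⟩
  have hP : (P : Matrix (Fin 3) (Fin 3) R) = !![0, 0, 1; 1, 0, 0; 0, 1, 0] := rfl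
  have e : L * P = P * corner a b c d h := by
    refine sl_ext ?_
    rw [Matrix.SpecialLinearGroup.coe_mul, Matrix.SpecialLinearGroup.coe_mul, hL, hP, coe_corner]
    ext i j
    fin_cases i <;> fin_cases j <;> simp [Matrix.mul_apply, Fin.sum_univ_three]
  rw [← eq_mul_inv_iff_mul_eq] at e
  exact e ▸ Near.conj P _

/-- The key identity behind the multiplicativity of Mennicke symbols. Multiplying `(a, b₁)` in the
upper left corner by `(b₂, a)` in the lower right one gives the first row `(a, b₁ b₂, b₁ a)`; its
last entry is cleared by the first column, and then the `1` created in the second row clears the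
rest. -/
theorem near_mennicke_mul {a b₁ b₂ : R} (h₁ : IsCoprime a b₁) (h₂ : IsCoprime a b₂) :
    Near 11 (mennicke a (b₁ * b₂)) (mennicke a b₁ * mennicke b₂ a) := by
  obtain ⟨c, d, h⟩ := exists_corner h₁
  obtain ⟨p, q, h'⟩ := exists_corner h₂.symm
  have hm : a * (q * d * b₂ - p) - b₁ * b₂ * (q * c) = 1 := by
    linear_combination q * b₂ * h + h'
  let L : SpecialLinearGroup (Fin 3) R :=
    ⟨!![1, 0, 0; 0, b₂, a; 0, p, q], by rw [det_fin_three]; simpa using h'⟩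
  have hL : (L : Matrix (Fin 3) (Fin 3) R) = !![1, 0, 0; 0, b₂, a; 0, p, q] := rfl
  let T {i j : Fin 3} (hij : i ≠ j) (t : R) : SpecialLinearGroup (Fin 3) R :=
    SpecialLinearGroup.transvection hij t
  have hT : ∀ {i j : Fin 3} (hij : i ≠ j) (t : R), Near 1 (T hij t) 1 :=
    fun hij t => near_transvection_three hij t
  have h01 : (0 : Fin 3) ≠ 1 := by decide
  have h02 : (0 : Fin 3) ≠ 2 := by decide
  have h12 : (1 : Fin 3) ≠ 2 := by decide
  let W : SpecialLinearGroup (Fin 3) R := ⟨!![1, 0, 0; 0, 0, 1; 0, -1, 0], by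
    rw [det_fin_three]; simp⟩
  have hW : (W : Matrix (Fin 3) (Fin 3) R) = !![1, 0, 0; 0, 0, 1; 0, -1, 0] := rfl
  have eW : W = T h12 1 * T h12.symm (-1) * T h12 1 := by
    refine sl_ext ?_
    simp only [Matrix.SpecialLinearGroup.coe_mul, hW, T, SpecialLinearGroup.transvection_coe]
    ext i j
    fin_cases i <;> fin_cases j <;>
      simp [Matrix.mul_apply, Fin.sum_univ_three, Matrix.single, Matrix.one_apply]
  have nW : Near 3 W 1 := by
    have := ((hT h12 1).mul (hT h12.symm (-1))).mul (hT h12 1)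
    rwa [← eW, mul_one, mul_one] at this
  have key : T h12.symm (-q) * (corner a b₁ c d h * L) =
      W * corner a (b₁ * b₂) (q * c) (q * d * b₂ - p) hm *
        (T h12.symm (d * b₂) * T h02.symm c * T h02 b₁) := by
    refine sl_ext ?_
    simp only [Matrix.SpecialLinearGroup.coe_mul, hW, hL, T, SpecialLinearGroup.transvection_coe,
      coe_corner]
    ext i j
    fin_cases i <;> fin_cases j <;>
      simp [Matrix.mul_apply, Fin.sum_univ_three, Matrix.single, Matrix.one_apply] <;>
      first
        | ring1
        | linear_combination h
        | linear_combination (-q) * h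
  have e1 := (hT h12.symm (-q)).mul (Near.refl (corner a b₁ c d h * L))
  have e2 := (nW.mul (Near.refl (corner a (b₁ * b₂) (q * c) (q * d * b₂ - p) hm))).mul
    (((hT h12.symm (d * b₂)).mul (hT h02.symm c)).mul (hT h02 b₁))
  rw [key] at e1
  simp only [one_mul, mul_one] at e1 e2
  have e3 := (near_mennicke h).mul ((near_lower_corner h' hL).trans (near_mennicke h'))
  exact ((near_mennicke hm).symm.trans (e2.symm.trans (e1.trans e3))).mono (by norm_num)

theorem near_mennicke_swap {a b : R} (h : IsCoprime a b) :
    Near 18 (mennicke a b) (mennicke b a) := by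
  have h1 := near_mennicke_mul (isCoprime_one_right (x := a)) h
  have h2 := (near_mennicke_one_right a).mul (Near.refl (mennicke b a))
  rw [one_mul] at h1 h2
  exact h1.trans h2

theorem near_mennicke_mul_right {a b₁ b₂ : R} (h₁ : IsCoprime a b₁) (h₂ : IsCoprime a b₂) :
    Near 29 (mennicke a (b₁ * b₂)) (mennicke a b₁ * mennicke a b₂) :=
  (near_mennicke_mul h₁ h₂).trans ((Near.refl _).mul (near_mennicke_swap h₂.symm))

theorem near_mennicke_pow_right {a b : R} (h : IsCoprime a b) {l : ℕ} (hl : 0 < l) :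
    Near (29 * l) (mennicke a (b ^ l)) (mennicke a b ^ l) := by
  induction l, hl using Nat.le_induction with
  | base => simpa using (Near.refl _).mono (Nat.zero_le 29)
  | succ l hl ih =>
    rw [pow_succ, pow_succ]
    exact ((near_mennicke_mul_right h.pow_right h).trans (ih.mul (Near.refl _))).mono
      (by linarith)

theorem near_mennicke_pow_left {a b : R} (h : IsCoprime a b) {l : ℕ} (hl : 0 < l) :
    Near (65 * l) (mennicke (a ^ l) b) (mennicke a b ^ l) :=
  ((near_mennicke_swap h.pow_left).trans ((near_mennicke_pow_right h.symm hl).trans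
    ((near_mennicke_swap h.symm).pow l))).mono (by linarith)

/-- Raising both entries to the power `l` amounts to raising the symbol to the power `l ^ 2`, up to
`O(l ^ 2)` commutators with an absolute constant. -/
theorem near_mennicke_pow_pow {a b : R} (h : IsCoprime a b) {l : ℕ} (hl : 0 < l) :
    Near (65 * l ^ 2 + 29 * l) (mennicke a b ^ l ^ 2) (mennicke (a ^ l) (b ^ l)) := by
  have := (near_mennicke_pow_right h.pow_left hl).trans ((near_mennicke_pow_left h hl).pow l)
  rw [← pow_mul, ← sq] at this
  exact this.symm.mono (le_of_eq (by ring))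

/-- Powers of the entries may be reduced modulo each other up to only `O(l)` commutators: the error
made by the elementary operation is bounded, and it occurs in an `l`-th power. -/
theorem near_mennicke_pow_add_mul {a b : R} (h : IsCoprime a b) (t : R) {l : ℕ} (hl : 0 < l) :
    Near (133 * l) (mennicke (a ^ l) ((b + t * a) ^ l)) (mennicke (a ^ l) (b ^ l)) := by
  have h' : IsCoprime a (b + t * a) := IsCoprime.add_mul_right_right_iff.2 h
  obtain ⟨s, hs⟩ : a ∣ (b + t * a) ^ l - b ^ l :=
    (Dvd.intro_left t (by ring)).trans (sub_dvd_pow_sub_pow (b + t * a) b l)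
  have e : (b + t * a) ^ l = b ^ l + s * a := by linear_combination hs
  have h1 := (near_mennicke_add_mul_right (h.pow_right (n := l)) s).pow l
  rw [← e] at h1
  exact ((near_mennicke_pow_left h'.pow_right hl).trans
    (h1.trans (near_mennicke_pow_left h.pow_right hl).symm)).mono (by linarith)

end MennickeMul

/-! ### Stable bounds from the Euclidean algorithm -/

section Euclid

variable {R : Type*} [EuclideanDomain R]

/-- Run the Euclidean algorithm on `(a, b)`, each step of which costs `O(l)` commutators. -/
theorem exists_near_mennicke_pow_one (a b : R) : IsCoprime a b →
    ∃ E : ℕ, ∀ l : ℕ, 0 < l → Near (E * l) (mennicke (a ^ l) (b ^ l)) 1 := by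
  refine EuclideanDomain.GCD.induction a b ?_ ?_
  · intro x hx
    refine ⟨13, fun l hl => (near_mennicke_unit_right _ ?_).mono (by linarith)⟩
    exact (isCoprime_zero_left.1 hx).pow l
  · intro a b _ ih hab
    have e : b % a + b / a * a = b := by rw [mul_comm]; exact EuclideanDomain.mod_add_div b a
    have hc : IsCoprime a (b % a) := by
      rw [← e] at hab
      exact IsCoprime.add_mul_right_right_iff.1 hab
    obtain ⟨E, hE⟩ := ih hc.symm
    refine ⟨151 + E, fun l hl => ?_⟩
    have h1 := near_mennicke_pow_add_mul hc (b / a) hl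
    rw [e] at h1
    exact (h1.trans ((near_mennicke_swap hc.pow).trans (hE l hl))).mono (by linarith)

theorem stablyBounded_mennicke {a b : R} (h : IsCoprime a b) :
    StablyBounded 65 (mennicke a b) := by
  obtain ⟨E, hE⟩ := exists_near_mennicke_pow_one a b h
  exact ⟨29 + E, fun l hl => ((near_mennicke_pow_pow h hl).trans (hE l hl)).mono (by linarith)⟩

theorem stablyBounded_of_lower_corner {L : SpecialLinearGroup (Fin 3) R} {a b c d : R}
    (h : a * d - b * c = 1)
    (hL : (L : Matrix (Fin 3) (Fin 3) R) = !![1, 0, 0; 0, a, b; 0, c, d]) :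
    StablyBounded 67 L :=
  (stablyBounded_mennicke ⟨d, -c, by linear_combination h⟩).of_near
    ((near_lower_corner h hL).trans (near_mennicke h))

end Euclid

/-! ### Reduction of the size of the matrix -/

section StableRange

variable {R : Type*} [EuclideanDomain R]

/-- The stable range condition for a principal ideal domain. The proof removes the irreducible
factors of `b` one at a time, correcting `t` by a multiple of the remaining cofactor. -/
theorem exists_isCoprime_add_mul {a c : R} (b : R) (hb : b ≠ 0)
    (h : ∃ x y z, x * a + y * b + z * c = 1) : ∃ t, IsCoprime (a + t * c) b := by
  induction b using WfDvdMonoid.induction_on_irreducible with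
  | zero => exact absurd rfl hb
  | unit u hu => exact ⟨0, by
    obtain ⟨u, rfl⟩ := hu
    exact ⟨0, ↑u⁻¹, by simp⟩⟩
  | mul b i hb0 hi ih =>
    obtain ⟨x, y, z, hxyz⟩ := h
    obtain ⟨t, ht⟩ := ih hb0 ⟨x, y * i, z, by linear_combination hxyz⟩
    rcases hi.isCoprime_or_dvd (a + t * c) with hc | hd
    · exact ⟨t, hc.symm.mul_right ht⟩
    · refine ⟨t + b, IsCoprime.mul_right (IsCoprime.symm ?_) ?_⟩
      · refine (hi.isCoprime_or_dvd _).resolve_right fun hd' => ?_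
        have h1 : i ∣ b * c := by
          have := dvd_sub hd' hd
          rwa [show a + (t + b) * c - (a + t * c) = b * c by ring] at this
        rcases hi.prime.dvd_or_dvd h1 with h2 | h2
        · exact hi.not_isUnit (ht.isUnit_of_dvd' hd h2)
        · have h3 : i ∣ a := (dvd_add_left (h2.mul_left t)).1 hd
          refine hi.not_isUnit (isUnit_of_dvd_one (hxyz ▸ ?_))
          exact dvd_add (dvd_add (h3.mul_left x) ((dvd_mul_right i b).mul_left y)) (h2.mul_left z)
      · have e : a + (t + b) * c = a + t * c + c * b := by ring
        rw [e]
        exact IsCoprime.add_mul_right_left_iff.2 ht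

end StableRange

section RowOperations

variable {R : Type*} [CommRing R] {ι : Type*} [Fintype ι] [DecidableEq ι]

theorem sum_inv_mul (g : SpecialLinearGroup ι R) (l k : ι) :
    ∑ i, g⁻¹ l i * g i k = (1 : Matrix ι ι R) l k := by
  rw [← Matrix.mul_apply, ← Matrix.SpecialLinearGroup.coe_mul, inv_mul_cancel,
    Matrix.SpecialLinearGroup.coe_one]

theorem coe_transvection_mul_apply {i j : ι} (hij : i ≠ j) (t : R) (g : SpecialLinearGroup ι R)
    (a k : ι) : (SpecialLinearGroup.transvection hij t * g) a k =
      g a k + if a = i then t * g j k else 0 := by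
  have e : ((SpecialLinearGroup.transvection hij t * g : SpecialLinearGroup ι R) :
      Matrix ι ι R) = Matrix.transvection i j t * (g : Matrix ι ι R) := rfl
  rw [e]
  split_ifs with h
  · subst h
    exact Matrix.transvection_mul_apply_same _ _ _ _ _
  · rw [add_zero]
    exact Matrix.transvection_mul_apply_of_ne _ _ _ _ h _ _

theorem near_transvection_mul (hι : 2 < Fintype.card ι) {i j : ι} (hij : i ≠ j) (t : R)
    (g : SpecialLinearGroup ι R) : Near 1 (SpecialLinearGroup.transvection hij t * g) g := by
  obtain ⟨k, hk⟩ : ∃ k, k ∉ ({i, j} : Finset ι) := by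
    by_contra! hall
    have := (Finset.card_le_card fun k (_ : k ∈ Finset.univ) => hall k).trans Finset.card_le_two
    rw [Finset.card_univ] at this
    omega
  simp only [Finset.mem_insert, Finset.mem_singleton, not_or] at hk
  exact Near.of_mul _ (near_transvection hij k hk.1 hk.2 t) rfl

/-- Adding multiples of the rows in `s` to the row `i₀`. -/
theorem exists_near_add_rows (hι : 2 < Fintype.card ι) (g : SpecialLinearGroup ι R) (i₀ : ι)
    (w : ι → R) (s : Finset ι) (hs : i₀ ∉ s) :
    ∃ h : SpecialLinearGroup ι R, Near s.card h g ∧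
      ∀ j k, h j k = g j k + if j = i₀ then ∑ i ∈ s, w i * g i k else 0 := by
  induction s using Finset.induction_on with
  | empty => exact ⟨g, Near.refl g, by simp⟩
  | insert i s hi ih =>
    simp only [Finset.mem_insert, not_or] at hs
    obtain ⟨h, hn, hh⟩ := ih hs.2
    refine ⟨SpecialLinearGroup.transvection hs.1 (w i) * h, ?_, fun j k => ?_⟩
    · rw [Finset.card_insert_of_notMem hi, add_comm]
      exact (near_transvection_mul hι _ _ _).trans hn
    · rw [coe_transvection_mul_apply, hh, hh i, if_neg (Ne.symm hs.1), Finset.sum_insert hi]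
      split_ifs <;> ring

/-- Adding multiples of the row `i₀` to the rows in `s`. -/
theorem exists_near_add_row (hι : 2 < Fintype.card ι) (g : SpecialLinearGroup ι R) (i₀ : ι)
    (w : ι → R) (s : Finset ι) (hs : i₀ ∉ s) :
    ∃ h : SpecialLinearGroup ι R, Near s.card h g ∧
      ∀ j k, h j k = g j k + if j ∈ s then w j * g i₀ k else 0 := by
  induction s using Finset.induction_on with
  | empty => exact ⟨g, Near.refl g, by simp⟩
  | insert i s hi ih =>
    simp only [Finset.mem_insert, not_or] at hs
    obtain ⟨h, hn, hh⟩ := ih hs.2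
    refine ⟨SpecialLinearGroup.transvection (Ne.symm hs.1) (w i) * h, ?_, fun j k => ?_⟩
    · rw [Finset.card_insert_of_notMem hi, add_comm]
      exact (near_transvection_mul hι _ _ _).trans hn
    · rw [coe_transvection_mul_apply, hh, hh i₀, if_neg hs.2]
      by_cases hj : j = i
      · subst hj
        simp [hi]
      · simp [hj]

end RowOperations

/-! ### Stabilization of the special linear group -/

section Stabilization

variable {R : Type*} [CommRing R]

/-- The block diagonal matrix with blocks `1` and `A`. -/
def oneBlock {n : ℕ} (A : Matrix (Fin n) (Fin n) R) : Matrix (Fin (n + 1)) (Fin (n + 1)) R :=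
  Matrix.of (Fin.cons (Fin.cons 1 0) fun i => Fin.cons 0 (A i))

theorem det_oneBlock {n : ℕ} (A : Matrix (Fin n) (Fin n) R) : (oneBlock A).det = A.det := by
  rw [det_succ_column_zero, Fin.sum_univ_succ]
  simp [oneBlock, Matrix.submatrix]
  rfl

theorem oneBlock_one (n : ℕ) : oneBlock (1 : Matrix (Fin n) (Fin n) R) = 1 := by
  ext i j
  refine Fin.cases ?_ (fun i => ?_) i <;> refine Fin.cases ?_ (fun j => ?_) j <;>
    simp [oneBlock, Matrix.one_apply, Fin.succ_ne_zero, (Fin.succ_ne_zero _).symm]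

theorem oneBlock_mul {n : ℕ} (A B : Matrix (Fin n) (Fin n) R) :
    oneBlock (A * B) = oneBlock A * oneBlock B := by
  ext i j
  refine Fin.cases ?_ (fun i => ?_) i <;> refine Fin.cases ?_ (fun j => ?_) j <;>
    simp [oneBlock, Matrix.mul_apply, Fin.sum_univ_succ]

/-- The stabilization homomorphism `SLₙ → SLₙ₊₁`, placing a matrix in the lower right corner. -/
def stabilize (R : Type*) [CommRing R] (n : ℕ) :
    SpecialLinearGroup (Fin n) R →* SpecialLinearGroup (Fin (n + 1)) R where
  toFun g := ⟨oneBlock g, (det_oneBlock _).trans g.2⟩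
  map_one' := sl_ext (oneBlock_one n)
  map_mul' _ _ := sl_ext (oneBlock_mul _ _)

theorem coe_stabilize {n : ℕ} (g : SpecialLinearGroup (Fin n) R) :
    (stabilize R n g : Matrix (Fin (n + 1)) (Fin (n + 1)) R) =
      Matrix.of (Fin.cons (Fin.cons 1 0) fun i => Fin.cons 0 (g i)) :=
  rfl

/-- A matrix whose first column is the first basis vector can be brought into the image of
`stabilize` by adding multiples of the other rows to the first. -/
theorem exists_near_stabilize_of_column {n : ℕ} (hn : 1 < n)
    (g : SpecialLinearGroup (Fin (n + 1)) R) (h0 : g 0 0 = 1)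
    (hs : ∀ i : Fin n, g i.succ 0 = 0) : ∃ g', Near n g (stabilize R n g') := by
  have hdet : (Matrix.of fun i j : Fin n => g i.succ j.succ).det = 1 := by
    have := g.2
    rw [det_succ_column_zero, Fin.sum_univ_succ] at this
    simpa [h0, hs, Matrix.submatrix] using this
  let g' : SpecialLinearGroup (Fin n) R := ⟨_, hdet⟩
  have hg' : ∀ i j, g' i j = g i.succ j.succ := fun i j => rfl
  let w : Fin n → R := fun i => -∑ k : Fin n, g 0 k.succ * g'⁻¹ k i
  have hw : ∀ k : Fin n, ∑ i, w i * g' i k = -g 0 k.succ := by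
    intro k
    simp only [w, neg_mul, Finset.sum_neg_distrib, Finset.sum_mul, mul_assoc]
    rw [Finset.sum_comm]
    simp only [← Finset.mul_sum, sum_inv_mul]
    simp [Matrix.one_apply]
  obtain ⟨h, hn, hh⟩ := exists_near_add_rows (by rw [Fintype.card_fin]; omega) g 0 (Fin.cons 0 w)
    (Finset.univ.map (Fin.succEmb n)) (by simp [Fin.succ_ne_zero])
  rw [Finset.card_map, Finset.card_univ, Fintype.card_fin] at hn
  refine ⟨g', ?_⟩
  suffices h = stabilize R n g' from this ▸ hn.symm
  refine sl_ext ?_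
  ext i j
  rw [hh, coe_stabilize]
  refine Fin.cases ?_ (fun i => ?_) i <;> refine Fin.cases ?_ (fun j => ?_) j
  · simp [h0, hs]
  · simp [← hg', hw]
  · simp [hs, Fin.succ_ne_zero]
  · simp [hg', Fin.succ_ne_zero]

end Stabilization

section Reduction

variable {R : Type*} [EuclideanDomain R]

/-- By the stable range condition, boundedly many row operations make the first two entries of the
first column coprime. -/
theorem exists_near_isCoprime {m : ℕ} (g : SpecialLinearGroup (Fin (m + 3)) R) :
    ∃ h : SpecialLinearGroup (Fin (m + 3)) R, Near (m + 3) h g ∧ IsCoprime (h 0 0) (h 1 0) := by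
  have hcard : 2 < Fintype.card (Fin (m + 3)) := by simp
  let s : Finset (Fin (m + 3)) := {0, 1}ᶜ
  have hs : s.card ≤ m + 3 := by simpa using s.card_le_univ
  let w : Fin (m + 3) → R := fun i => g⁻¹ 0 i
  set c := ∑ i ∈ s, w i * g i 0 with hc
  have h01 : (0 : Fin (m + 3)) ≠ 1 := by simp
  have hw : w 0 * g 0 0 + w 1 * g 1 0 + c = 1 := by
    have e : ∑ i, w i * g i 0 = 1 := (sum_inv_mul g 0 0).trans (Matrix.one_apply_eq _)
    rw [← Finset.sum_add_sum_compl {0, 1}, Finset.sum_pair h01] at e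
    exact e
  by_cases h1 : g 1 0 = 0
  · obtain ⟨h, hn, hh⟩ := exists_near_add_rows hcard g 1 w s (by simp [s])
    refine ⟨h, hn.mono hs, ?_⟩
    rw [hh, hh, if_neg h01, if_pos rfl, ← hc, h1]
    exact ⟨w 0, 1, by linear_combination hw - w 1 * h1⟩
  · obtain ⟨t, ht⟩ := exists_isCoprime_add_mul (a := g 0 0) (c := c) (g 1 0) h1
      ⟨w 0, w 1, 1, by linear_combination hw⟩
    obtain ⟨h, hn, hh⟩ := exists_near_add_rows hcard g 0 (fun i => t * w i) s (by simp [s])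
    refine ⟨h, hn.mono hs, ?_⟩
    rw [hh, hh, if_neg h01.symm, if_pos rfl, add_zero]
    simpa only [mul_assoc, ← Finset.mul_sum, ← hc] using ht

/-- Every matrix of size at least three is a bounded number of commutators away from a matrix of
smaller size. -/
theorem exists_near_stabilize (m : ℕ) (g : SpecialLinearGroup (Fin (m + 3)) R) :
    ∃ g', Near (3 * m + 12) g (stabilize R (m + 2) g') := by
  have hcard : 2 < Fintype.card (Fin (m + 3)) := by simp
  have h01 : (0 : Fin (m + 3)) ≠ 1 := by simp
  have h02 : (0 : Fin (m + 3)) ≠ 2 := Fin.ne_of_val_ne (by rw [Fin.val_two]; simp)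
  have h12 : (1 : Fin (m + 3)) ≠ 2 := Fin.ne_of_val_ne (by rw [Fin.val_two]; simp)
  obtain ⟨g₁, n₁, p, q, hpq⟩ := exists_near_isCoprime g
  -- Make the third entry of the first column equal to `1`.
  obtain ⟨g₂, n₂, e₂⟩ := exists_near_add_rows hcard g₁ 2
    (fun i => (1 - g₁ 2 0) * if i = 0 then p else q) {0, 1} (by simp [h02.symm, h12.symm])
  have g₂20 : g₂ 2 0 = 1 := by
    rw [e₂, if_pos rfl, Finset.sum_pair h01, if_pos rfl, if_neg h01.symm]
    linear_combination (1 - g₁ 2 0) * hpq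
  rw [Finset.card_pair h01] at n₂
  -- Use it to make the first entry equal to `1`.
  obtain ⟨g₃, n₃, e₃⟩ := exists_near_add_rows hcard g₂ 0 (fun _ => 1 - g₂ 0 0) {2}
    (by simpa using h02)
  have g₃00 : g₃ 0 0 = 1 := by
    rw [e₃, if_pos rfl, Finset.sum_singleton, g₂20]
    ring
  rw [Finset.card_singleton] at n₃
  -- Clear the rest of the column.
  obtain ⟨g₄, n₄, e₄⟩ := exists_near_add_row hcard g₃ 0 (fun j => -g₃ j 0)
    (Finset.univ.map (Fin.succEmb (m + 2))) (by simp [Fin.succ_ne_zero])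
  rw [Finset.card_map, Finset.card_univ, Fintype.card_fin] at n₄
  obtain ⟨g', n₅⟩ := exists_near_stabilize_of_column (by omega) g₄
    (by rw [e₄, g₃00]; simp [Fin.succ_ne_zero]) (fun i => by rw [e₄, g₃00]; simp)
  exact ⟨g', (n₁.symm.trans (n₂.symm.trans (n₃.symm.trans (n₄.symm.trans n₅)))).mono
    (by omega)⟩

/-- Reduce to size two, where the stable bound comes from Mennicke symbols. -/
theorem exists_stablyBounded (R : Type*) [EuclideanDomain R] (m : ℕ) :
    ∃ K, ∀ g : SpecialLinearGroup (Fin (m + 3)) R, StablyBounded K g := by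
  induction m with
  | zero =>
    refine ⟨12 + 67, fun g => ?_⟩
    obtain ⟨g', h⟩ := exists_near_stabilize 0 g
    refine StablyBounded.of_near (stablyBounded_of_lower_corner (a := g' 0 0) (b := g' 0 1)
      (c := g' 1 0) (d := g' 1 1) ?_ ?_) h
    · rw [← Matrix.det_fin_two]
      exact g'.2
    · rw [coe_stabilize]
      ext i j
      fin_cases i <;> fin_cases j <;> rfl
  | succ m ih =>
    obtain ⟨K, hK⟩ := ih
    refine ⟨3 * (m + 1) + 12 + K, fun g => ?_⟩
    obtain ⟨g', h⟩ := exists_near_stabilize (m + 1) g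
    exact ((hK g').map (stabilize R (m + 3))).of_near h

end Reduction

theorem theorem1p4 {R : Type*} [EuclideanDomain R] (n : ℕ) (hn : 6 ≤ n) :
    (∀ ψ : Matrix.SpecialLinearGroup (Fin n) R → ℝ,
        IsQuasiHomomorphism ψ → ∃ C : ℝ, ∀ g : Matrix.SpecialLinearGroup (Fin n) R, |ψ g| ≤ C) ∧
      (∀ g : Matrix.SpecialLinearGroup (Fin n) R, HasStableCommutatorLength g 0) := by
  obtain ⟨m, rfl⟩ : ∃ m, n = m + 3 := ⟨n - 3, by omega⟩
  obtain ⟨K, hK⟩ := exists_stablyBounded R m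
  exact ⟨fun ψ hψ => hψ.bounded_of_stablyBounded hK, hasStableCommutatorLength_zero hK⟩
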